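/- Let $\mathbb{F}_q$ be a finite field and write $[k]=\{1,\dots,k\}$. An instance $(m,n,\mathcal{X},f)$ of the index coding problem consists of side-information sets $\mathcal{X}_i\subseteq[n]$ $(i\in[m])$ and a demand function $f:[m]\to[n]$ with $f(i)\notin\mathcal{X}_i$ for all $i$. Let $$\kappa_q=\kappa_q(m,n,\mathcal{X},f)=\min\bigl\{\operatorname{rank}\{u^{(i)}+e_{f(i)}\}_{i\in[m]} : u^{(i)}\in\mathbb{F}_q^n,\ \operatorname{supp}(u^{(i)})\subseteq\mathcal{X}_i\bigr\},$$ where $e_j$ is the $j$-th unit vector. A linear $\eta$-randomized $(m,n,\mathcal{X},f)$-index code of length $N$ over $\mathbb{F}_q$, based on an $(n+\eta)\times N$ matrix $L$ over $\mathbb{F}_q$, is the encoding $(x,g)\mapsto(x\,|\,g)L$ of $x\in\mathbb{F}_q^n$, $g\in\mathbb{F}_q^\eta$, such that for every $i\in[m]$ there is a decoding function $D_i$ with $D_i((x\,|\,g)L,\,x_{\mathcal{X}_i})=x_{f(i)}$ for all $x$ and $g$. Let $0\le t\le n-1$ and $\mu\ge 0$, and let the coordinates of the random vectors $X\in\mathbb{F}_q^n$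 and $G\in\mathbb{F}_q^\eta$ all be independent and uniformly distributed over $\mathbb{F}_q$. The code is $(\mu,t)$-strongly secure if $\mu\le N$ and $$H\bigl(X_{[n]\setminus A}\mid (X\,|\,G)L[W],\,X_A\bigr)=H\bigl(X_{[n]\setminus A}\bigr)$$ for all $A\subseteq[n]$ with $|A|=t$ and all $W\subseteq[N]$ with $|W|\le\mu$, where $H$ is Shannon entropy and $L[W]$ is the submatrix of the columns of $L$ indexed by $W$. Then every $(\mu,t)$-strongly secure linear $\eta$-randomized $(m,n,\mathcal{X},f)$-index code over $\mathbb{F}_q$ has length $N\ge\kappa_q+\mu$. -/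

import Mathlib

noncomputable section

namespace IndexCoding

/-! ### Shannon entropy of finitely valued random variables -/

section Entropy

variable {Ω S T : Type*}

/-- `Pr(Y = y)` for a random variable `Y` on the discrete probability space `(Ω, P)`. -/
def prob (P : PMF Ω) (Y : Ω → S) (y : S) : ℝ :=
  (P.map Y y).toReal

/-- The binary entropy `H(Y) = -∑ y, Pr(Y = y) log₂ Pr(Y = y)`. -/
def entropy [Fintype S] (P : PMF Ω) (Y : Ω → S) : ℝ :=
  -∑ y, prob P Y y * Real.logb 2 (prob P Y y)

/-- The binary conditional entropy
`H(Y | Z) = -∑ y, ∑ z, Pr(Y = y, Z = z) log₂ Pr(Y = y | Z = z)`. Terms with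
`Pr(Y = y, Z = z) = 0` vanish. -/
def condEntropy [Fintype S] [Fintype T] (P : PMF Ω) (Y : Ω → S) (Z : Ω → T) : ℝ :=
  -∑ y, ∑ z, prob P (fun ω => (Y ω, Z ω)) (y, z) *
    Real.logb 2 (prob P (fun ω => (Y ω, Z ω)) (y, z) / prob P Z z)

end Entropy

/-! ### Instances of index coding with side information -/

/-- An instance `(m, n, 𝒳, f)` of the index coding problem with side information: the `i`-th of
`m` receivers owns the messages indexed by `side i = 𝒳ᵢ` and requests the message indexed by
`demand i = f i`, which it does not own. -/
structure Problem (m n : ℕ) where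
  side : Fin m → Finset (Fin n)
  demand : Fin m → Fin n
  demand_notMem : ∀ i, demand i ∉ side i

/-- The vector `u` is supported on `E`. -/
def SupportedOn {F : Type*} [Zero F] {n : ℕ} (u : Fin n → F) (E : Finset (Fin n)) : Prop :=
  ∀ j, u j ≠ 0 → j ∈ E

/-- `κ_q(m, n, 𝒳, f)` over the field `F` with `q` elements: the minimum, over all choices of
vectors `uᵢ ∈ Fⁿ` supported on `𝒳ᵢ`, of the rank of the family `uᵢ + e_{f i}`. The set below is
nonempty, as all `uᵢ` may be zero. -/
def Problem.kappa {m n : ℕ} (I : Problem m n) (F : Type*) [Field F] : ℕ :=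
  sInf {r | ∃ u : Fin m → Fin n → F, (∀ i, SupportedOn (u i) (I.side i)) ∧
    r = Module.finrank F
      (Submodule.span F (Set.range fun i => u i + Pi.single (I.demand i) (1 : F)))}

/-! ### Randomized index codes -/

/-- `enc` is an `η`-randomized index code of length `N` for the instance `I`: from the
transmission `enc x g` and its side information, each receiver can decode the message that it
requests, whatever the messages `x` and the realization `g` of the random symbols are. -/
def Problem.IsRandomizedIndexCode {m n η N : ℕ} {F : Type*} (I : Problem m n)
    (enc : (Fin n → F) → (Fin η → F) → (Fin N → F)) : Prop :=
  ∀ i, ∃ dec : (Fin N → F) → (I.side i → F) → F,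
    ∀ x g, dec (enc x g) (fun j => x j) = x (I.demand i)

/-- The linear encoding function `(x, g) ↦ (x | g) L`. The rows of `L` that multiply the messages
are indexed by `Fin n`, those that multiply the random symbols by `Fin η`. -/
def linearEncoding {n η N : ℕ} {F : Type*} [Field F] (L : Matrix (Fin n ⊕ Fin η) (Fin N) F)
    (x : Fin n → F) (g : Fin η → F) : Fin N → F :=
  Matrix.vecMul (Sum.elim x g) L

/-- The joint law of `(X, G)`: the messages `X₁, …, Xₙ` and the random symbols `G₁, …, G_η` are
independent and uniformly distributed over `F`, that is, `(X, G)` is uniform on `Fⁿ × F^η`. -/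
def sourceLaw (n η : ℕ) (F : Type*) [Field F] [Fintype F] :
    PMF ((Fin n → F) × (Fin η → F)) :=
  PMF.uniformOfFintype _

/-- The subvector `x_B` of `x`. -/
def restrict {n : ℕ} {F : Type*} (B : Finset (Fin n)) (x : Fin n → F) : B → F :=
  fun j => x j

/-- The matrix `L[W]` formed by the columns of `L` indexed by `W`. -/
def columns {ι : Type*} {N : ℕ} {F : Type*} (L : Matrix ι (Fin N) F) (W : Finset (Fin N)) :
    Matrix ι W F :=
  L.submatrix id Subtype.val

/-- The linear code based on `L` is `(μ, t)`-strongly secure, where `μ ≤ N`: an adversary who owns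
any `t` messages `X_A` and listens to at most `μ` transmissions (those indexed by `W`) gains no
information about the other messages, `H(X_{Aᶜ} | (X | G) L[W], X_A) = H(X_{Aᶜ})`. -/
def IsStronglySecure {n η N : ℕ} {F : Type*} [Field F] [Fintype F]
    (L : Matrix (Fin n ⊕ Fin η) (Fin N) F) (μ t : ℕ) : Prop :=
  μ ≤ N ∧ ∀ (A : Finset (Fin n)) (W : Finset (Fin N)), A.card = t → W.card ≤ μ →
    condEntropy (sourceLaw n η F) (fun ω => restrict Aᶜ ω.1)
        (fun ω => (Matrix.vecMul (Sum.elim ω.1 ω.2) (columns L W), restrict A ω.1)) =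
      entropy (sourceLaw n η F) (fun ω => restrict Aᶜ ω.1)

end IndexCoding

end

/-! Let `K` be the space of combinations `d` of the columns of `L` in which the random symbols
cancel, and let `ψ` send `d` to its message part. Decoding may be taken linear, so each receiver
yields some `d i` in `K` whose message part is `e_{f i}` plus a vector supported on its side
information; hence `κ ≤ rank ψ`. By security, an element of `K` supported on `μ` columns has zero
message part, so `ψ` factors through the other `N - μ` coordinates and `rank ψ ≤ N - μ`. -/

namespace IndexCoding

section Probability

variable {Ω S T : Type*} (P : PMF Ω) (Y : Ω → S) (Z : Ω → T)

theorem prob_nonneg (y : S) : 0 ≤ prob P Y y :=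
  ENNReal.toReal_nonneg

theorem prob_pos_iff (y : S) : 0 < prob P Y y ↔ ∃ ω ∈ P.support, Y ω = y := by
  rw [← PMF.mem_support_map_iff, PMF.mem_support_iff, prob, ENNReal.toReal_pos_iff]
  exact ⟨fun h => h.1.ne', fun h => ⟨pos_iff_ne_zero.2 h, (PMF.apply_ne_top _ _).lt_top⟩⟩

open Classical in
theorem prob_eq_sum [Fintype Ω] (y : S) :
    prob P Y y = ∑ ω, if Y ω = y then (P ω).toReal else 0 := by
  rw [prob, PMF.map_apply, tsum_fintype, ENNReal.toReal_sum]
  · refine Finset.sum_congr rfl fun ω _ => ?_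
    by_cases h : Y ω = y
    · simp [h]
    · simp [h, Ne.symm h]
  · intro ω _
    split_ifs
    · exact PMF.apply_ne_top _ _
    · exact ENNReal.zero_ne_top

theorem sum_prob [Fintype Ω] [Fintype S] : ∑ y, prob P Y y = 1 := by
  classical
  simp only [prob_eq_sum]
  rw [Finset.sum_comm]
  simp only [Finset.sum_ite_eq, Finset.mem_univ, if_true]
  rw [← ENNReal.toReal_sum fun ω _ => PMF.apply_ne_top _ _, ← tsum_fintype (L := .unconditional _),
    P.tsum_coe]
  rfl

theorem sum_prob_pair_right [Fintype Ω] [Fintype T] (y : S) :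
    ∑ z, prob P (fun ω => (Y ω, Z ω)) (y, z) = prob P Y y := by
  classical
  simp only [prob_eq_sum, Prod.mk.injEq]
  rw [Finset.sum_comm]
  refine Finset.sum_congr rfl fun ω _ => ?_
  by_cases h : Y ω = y <;> simp [h]

/-- If conditioning on `Z` does not decrease the entropy of `Y`, then any two values of `Y` and `Z`
that occur with positive probability occur jointly with positive probability. -/
theorem prob_pair_pos_of_condEntropy_eq [Fintype Ω] [Fintype S] [Fintype T]
    (h : condEntropy P Y Z = entropy P Y) {y₀ : S} {z₀ : T}
    (hy : 0 < prob P Y y₀) (hz : 0 < prob P Z z₀) :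
    0 < prob P (fun ω => (Y ω, Z ω)) (y₀, z₀) := by
  by_contra hyz
  have hyz₀ : prob P (fun ω => (Y ω, Z ω)) (y₀, z₀) = 0 :=
    le_antisymm (not_lt.1 hyz) (prob_nonneg ..)
  set J : S → T → ℝ := fun y z => prob P (fun ω => (Y ω, Z ω)) (y, z) with hJ
  -- This is `log r ≤ r - 1` at `r = p(y) p(z) / J y z`; summed, it says that mutual information is
  -- nonnegative.
  have hle : ∀ y z, J y z * (Real.log (prob P Y y) - Real.log (J y z / prob P Z z)) ≤
      prob P Y y * prob P Z z - J y z := by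
    intro y z
    rcases (prob_nonneg P (fun ω => (Y ω, Z ω)) (y, z)).eq_or_lt with h0 | h0
    · have : J y z = 0 := h0.symm
      rw [this]
      have := mul_nonneg (prob_nonneg P Y y) (prob_nonneg P Z z)
      simpa
    · obtain ⟨ω, hω, e⟩ := (prob_pos_iff ..).1 h0
      have h1 : 0 < prob P Y y := (prob_pos_iff ..).2 ⟨ω, hω, congrArg Prod.fst e⟩
      have h2 : 0 < prob P Z z := (prob_pos_iff ..).2 ⟨ω, hω, congrArg Prod.snd e⟩
      have h0 : 0 < J y z := h0
      rw [← Real.log_div h1.ne' (div_pos h0 h2).ne']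
      have h3 := Real.log_le_sub_one_of_pos (div_pos h1 (div_pos h0 h2))
      calc _ ≤ J y z * (prob P Y y / (J y z / prob P Z z) - 1) :=
            mul_le_mul_of_nonneg_left h3 h0.le
        _ = _ := by field_simp
  -- Strictness comes from `(y₀, z₀)`: the left term is 0, the right one `p(y₀) p(z₀) > 0`.
  have hlt : ∑ y, ∑ z, J y z * (Real.log (prob P Y y) - Real.log (J y z / prob P Z z)) <
      ∑ y, ∑ z, (prob P Y y * prob P Z z - J y z) := by
    refine Finset.sum_lt_sum (fun y _ => Finset.sum_le_sum fun z _ => hle y z)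
      ⟨y₀, Finset.mem_univ _, Finset.sum_lt_sum (fun z _ => hle y₀ z)
        ⟨z₀, Finset.mem_univ _, ?_⟩⟩
    have : J y₀ z₀ = 0 := hyz₀
    rw [this]
    simpa using mul_pos hy hz
  have hright : ∑ y, ∑ z, (prob P Y y * prob P Z z - J y z) = 0 := by
    simp only [Finset.sum_sub_distrib, ← Finset.mul_sum, sum_prob, hJ, sum_prob_pair_right,
      mul_one, sub_self, Finset.sum_const_zero]
  have hleft : ∑ y, ∑ z, J y z * (Real.log (prob P Y y) - Real.log (J y z / prob P Z z)) =
      Real.log 2 * (condEntropy P Y Z - entropy P Y) := by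
    simp only [condEntropy, entropy, Real.logb, mul_sub, Finset.sum_sub_distrib,
      ← Finset.sum_mul, mul_div_assoc', ← Finset.sum_div, hJ, sum_prob_pair_right]
    field_simp
    ring
  rw [hleft, hright, h, sub_self, mul_zero] at hlt
  exact lt_irrefl _ hlt

end Probability

section LinearCodes

variable {F : Type*} [Field F] {m n η N : ℕ}

/-- The messages' part of `L` as a linear map on column vectors. -/
abbrev messageMap (L : Matrix (Fin n ⊕ Fin η) (Fin N) F) : (Fin N → F) →ₗ[F] (Fin n → F) :=
  (L.submatrix Sum.inl id).mulVecLin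

/-- The random symbols' part of `L` as a linear map on column vectors. -/
abbrev randomMap (L : Matrix (Fin n ⊕ Fin η) (Fin N) F) : (Fin N → F) →ₗ[F] (Fin η → F) :=
  (L.submatrix Sum.inr id).mulVecLin

theorem linearEncoding_dotProduct (L : Matrix (Fin n ⊕ Fin η) (Fin N) F) (x : Fin n → F)
    (g : Fin η → F) (d : Fin N → F) :
    linearEncoding L x g ⬝ᵥ d = x ⬝ᵥ messageMap L d + g ⬝ᵥ randomMap L d := by
  rw [linearEncoding, ← Matrix.dotProduct_mulVec, dotProduct, Fintype.sum_sum_type]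
  rfl

/-- Each receiver of a linear code can decode linearly. -/
theorem Problem.IsRandomizedIndexCode.exists_decoding_vector {I : Problem m n}
    {L : Matrix (Fin n ⊕ Fin η) (Fin N) F} (h : I.IsRandomizedIndexCode (linearEncoding L))
    (i : Fin m) :
    ∃ d : Fin N → F, randomMap L d = 0 ∧
      SupportedOn (messageMap L d - Pi.single (I.demand i) (1 : F)) (I.side i) := by
  obtain ⟨dec, hdec⟩ := h i
  let proj : Fin n ⊕ Fin η → ((Fin n ⊕ Fin η → F) →ₗ[F] F) := LinearMap.proj
  let obs : Fin N ⊕ I.side i → ((Fin n ⊕ Fin η → F) →ₗ[F] F) :=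
    Sum.elim (fun k => LinearMap.proj k ∘ₗ L.vecMulLinear) (fun j => proj (Sum.inl j))
  -- A source with zero observations looks to the receiver like the zero source, so its demanded
  -- message is 0. The demand is therefore a linear combination of the observations.
  have hker : ⨅ k, LinearMap.ker (obs k) ≤ LinearMap.ker (proj (Sum.inl (I.demand i))) := by
    intro v hv
    simp only [Submodule.mem_iInf, LinearMap.mem_ker] at hv
    have hv₁ : linearEncoding L (v ∘ Sum.inl) (v ∘ Sum.inr) = 0 := by
      funext k
      have := hv (Sum.inl k)
      simpa [obs, linearEncoding] using this
    have hv₂ : (fun j : I.side i => (v ∘ Sum.inl) j.1) = fun j => (0 : Fin n → F) j.1 :=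
      funext fun j => hv (Sum.inr j)
    have h0 : linearEncoding L 0 0 = 0 := by
      have : (Sum.elim 0 0 : Fin n ⊕ Fin η → F) = 0 := Sum.elim_zero_zero
      rw [linearEncoding, this, Matrix.zero_vecMul]
    have e := hdec (v ∘ Sum.inl) (v ∘ Sum.inr)
    rw [hv₁, hv₂, ← h0, hdec 0 0] at e
    exact e.symm
  obtain ⟨c, hc⟩ := (Submodule.mem_span_range_iff_exists_fun F).1
    (mem_span_of_iInf_ker_le_ker hker)
  have key : ∀ x g, linearEncoding L x g ⬝ᵥ (c ∘ Sum.inl) +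
      ∑ j : I.side i, c (Sum.inr j) * x j = x (I.demand i) := by
    intro x g
    have := congrArg (fun φ => φ (Sum.elim x g)) hc
    simpa [obs, proj, Fintype.sum_sum_type, linearEncoding, dotProduct, mul_comm] using this
  simp only [linearEncoding_dotProduct] at key
  refine ⟨c ∘ Sum.inl, ?_, ?_⟩
  · funext r
    have := key 0 (Pi.single r 1)
    simpa only [zero_dotProduct, Pi.zero_apply, mul_zero, Finset.sum_const_zero, zero_add,
      add_zero, single_dotProduct, one_mul] using this
  · intro j hj
    by_contra hjs
    apply hj
    have := key (Pi.single j 1) 0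
    rw [Finset.sum_eq_zero, single_dotProduct, one_mul, zero_dotProduct, add_zero, add_zero]
      at this
    · rw [Pi.sub_apply, this, Pi.single_comm, sub_self]
    · rintro ⟨k, hk⟩ -
      have : k ≠ j := fun e => hjs (e ▸ hk)
      simp [this]

/-- The message part of a randomness-free combination of the columns in a secure set of
transmissions vanishes. -/
theorem IsStronglySecure.messageMap_eq_zero [Fintype F]
    {L : Matrix (Fin n ⊕ Fin η) (Fin N) F} {μ t : ℕ} (h : IsStronglySecure L μ t) (ht : t < n)
    {W : Finset (Fin N)} (hW : W.card ≤ μ) {d : Fin N → F} (hd : SupportedOn d W)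
    (hr : randomMap L d = 0) : messageMap L d = 0 := by
  funext j
  -- Room for `t` known messages other than `j` is where `t < n` enters.
  obtain ⟨A, hA, hAt⟩ := Finset.exists_subset_card_eq (s := Finset.univ.erase j) (n := t) (by
    rw [Finset.card_erase_of_mem (Finset.mem_univ j), Finset.card_fin]
    omega)
  have hjA : j ∉ A := fun hj => Finset.notMem_erase j _ (hA hj)
  have hsupp : ∀ ω, ω ∈ (sourceLaw n η F).support := fun ω => by simp [sourceLaw]
  -- The values `e_j` off `A` and zero observations are each possible, hence jointly possible: some
  -- `g` makes the message `e_j` invisible on `W`.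
  have hpos := prob_pair_pos_of_condEntropy_eq _ _ _ (h.2 A W hAt hW)
    ((prob_pos_iff ..).2 ⟨(Pi.single j 1, 0), hsupp _, rfl⟩)
    ((prob_pos_iff ..).2 ⟨(0, 0), hsupp _, rfl⟩)
  obtain ⟨⟨x, g⟩, -, e⟩ := (prob_pos_iff ..).1 hpos
  simp only [Prod.mk.injEq] at e
  obtain ⟨e₁, e₂, e₃⟩ := e
  have hx : x = Pi.single j 1 := by
    funext k
    by_cases hk : k ∈ A
    · have hkj : k ≠ j := fun e => hjA (e ▸ hk)
      rw [Pi.single_eq_of_ne hkj]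
      exact congrFun e₃ ⟨k, hk⟩
    · exact congrFun e₁ ⟨k, Finset.mem_compl.2 hk⟩
  have hobs : ∀ k ∈ W, linearEncoding L x g k = 0 := by
    intro k hk
    have h0 : (Sum.elim 0 0 : Fin n ⊕ Fin η → F) = 0 := Sum.elim_zero_zero
    rw [h0, Matrix.zero_vecMul] at e₂
    exact congrFun e₂ ⟨k, hk⟩
  have hdot : linearEncoding L x g ⬝ᵥ d = 0 := by
    refine Finset.sum_eq_zero fun k _ => ?_
    by_cases hk : d k = 0
    · rw [hk, mul_zero]
    · rw [hobs k (hd k hk), zero_mul]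
  rwa [linearEncoding_dotProduct, hr, dotProduct_zero, add_zero, hx, single_dotProduct,
    one_mul] at hdot

theorem finrank_range_le_of_ker_le_ker {U V V' : Type*} [AddCommGroup U] [Module F U]
    [FiniteDimensional F U] [AddCommGroup V] [Module F V] [AddCommGroup V'] [Module F V']
    {φ : U →ₗ[F] V} {ψ : U →ₗ[F] V'} (h : LinearMap.ker φ ≤ LinearMap.ker ψ) :
    Module.finrank F (LinearMap.range ψ) ≤ Module.finrank F (LinearMap.range φ) := by
  have h₁ := φ.finrank_range_add_finrank_ker
  have h₂ := ψ.finrank_range_add_finrank_ker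
  have h₃ := Submodule.finrank_mono h
  omega

end LinearCodes

end IndexCoding

open IndexCoding in
theorem mainTheorem5 {F : Type*} [Field F] [Fintype F] {m n η N : ℕ}
    (I : IndexCoding.Problem m n) (L : Matrix (Fin n ⊕ Fin η) (Fin N) F) (μ t : ℕ) (ht : t < n)
    (hcode : I.IsRandomizedIndexCode (IndexCoding.linearEncoding L))
    (hsec : IndexCoding.IsStronglySecure L μ t) :
    I.kappa F + μ ≤ N := by
  have hμ : μ ≤ N := hsec.1
  obtain ⟨W, -, hW⟩ := Finset.exists_subset_card_eq (s := (Finset.univ : Finset (Fin N)))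
    (n := μ) (by rwa [Finset.card_fin])
  let K := LinearMap.ker (randomMap L)
  let ψ : K →ₗ[F] (Fin n → F) := messageMap L ∘ₗ K.subtype
  let φ : K →ₗ[F] ((Wᶜ : Finset (Fin N)) → F) := LinearMap.funLeft F F Subtype.val ∘ₗ K.subtype
  -- The kernel of `φ` consists of the elements of `K` supported on `W`.
  have hker : LinearMap.ker φ ≤ LinearMap.ker ψ := by
    rintro ⟨d, hd⟩ hφ
    refine hsec.messageMap_eq_zero ht hW.le (fun k hk => ?_) hd
    by_contra hkW
    exact hk (congrFun hφ ⟨k, Finset.mem_compl.2 hkW⟩)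
  have hψ : Module.finrank F (LinearMap.range ψ) ≤ N - μ := by
    refine (finrank_range_le_of_ker_le_ker hker).trans ((Submodule.finrank_le _).trans ?_)
    rw [Module.finrank_fintype_fun_eq_card, Fintype.card_coe, Finset.card_compl, hW,
      Fintype.card_fin]
  choose d hd₀ hd using hcode.exists_decoding_vector
  have hκ : I.kappa F ≤ Module.finrank F (LinearMap.range ψ) := by
    have hle : I.kappa F ≤ Module.finrank F (Submodule.span F (Set.range fun i =>
        messageMap L (d i) - Pi.single (I.demand i) 1 + Pi.single (I.demand i) (1 : F))) :=
      Nat.sInf_le ⟨fun i => messageMap L (d i) - Pi.single (I.demand i) 1, hd, rfl⟩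
    refine hle.trans (Submodule.finrank_mono (Submodule.span_le.2 ?_))
    rintro _ ⟨i, rfl⟩
    exact ⟨⟨d i, hd₀ i⟩, (sub_add_cancel _ _).symm⟩
  omega
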